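/- Let $k\ge 1$, $m\ge 1$, and let $$A=\begin{bmatrix}\widehat\Lambda & E^*\\ E & A_2\end{bmatrix}$$ be a real symmetric or complex Hermitian matrix, where $\widehat\Lambda=\mathrm{diag}(\theta_1,\dots,\theta_k)$ with $\theta_i\in\mathbb R$, $E=[E_1,\dots,E_k]$ has $m$ rows and columns $E_i$, and $A_2$ is $m\times m$ with eigenvalues $\lambda_1(A_2),\dots,\lambda_m(A_2)$. Let $\|\cdot\|$ be the Euclidean norm. For each $i$ put $$A_0=\begin{bmatrix}\widehat\Lambda & 0\\ 0 & A_2\end{bmatrix},\qquad F=\begin{bmatrix}0 & F_i^*\\ F_i & 0\end{bmatrix},\qquad F_i=[0,\dots,0,E_i,0,\dots,0]\ (E_i\text{ in the }i\text{th column}),\qquad \widetilde E=\begin{bmatrix}0 & E^*\\ E & 0\end{bmatrix}-F,$$ so that $A=A_0+\widetilde E+F$. An *eigenvalue path from $\theta_i$* is a continuous function $\lambda_i:[0,1]\to\mathbb R$ with $\lambda_i(0)=\theta_i$ such that $\lambda_i(t)$ is an eigenvalue of $A_0+\widetilde E+tF$ for every $t\in[0,1]$; in particular $\lambda_i(1)$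 is an eigenvalue of $A$. For positive numbers $\delta_i$ and $\delta_{i,j}$ ($j\ne i$) write $$d_i=\frac{1}{\delta_i-\sum_{j\ne i}\|E_j\|^2/\delta_{i,j}} .$$ 1. For every $i$ an eigenvalue path from $\theta_i$ exists. 2. Let $S\subseteq\{1,\dots,k\}$ (for instance all of $\{1,\dots,k\}$) and suppose that for every $i\in S$ $$\delta_i=\min_j|\theta_i-\lambda_j(A_2)|-\|E_i\|>0,\qquad \delta_{i,j}=|\theta_i-\theta_j|-\|E_i\|>0\quad(1\le j\le k,\ j\ne i),$$ and that $d_i$ is defined and $d_i>0$. Then there are pairwise distinct eigenvalues $\lambda_i$ ($i\in S$) of $A$, where $\lambda_i=\lambda_i(1)$ for an eigenvalue path from $\theta_i$, such that $$|\lambda_i-\theta_i|\le d_i\|E_i\|^2\qquad(i\in S).$$ 3. Let $1\le i\le k$, let $\lambda_i(\cdot)$ be any eigenvalue path from $\theta_i$, and let $\delta_i$ and $\delta_{i,j}$ ($j\neq i$) be any numbers with $$0<\delta_i\le\min_{j,\,0\le t\le1}|\lambda_i(t)-\lambda_j(A_2)|,\qquad 0<\delta_{i,j}\le\min_{0\le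 t\le1}|\lambda_i(t)-\theta_j|,$$ for which $d_i$ is defined and $d_i>0$. Then the eigenvalue $\lambda_i(1)$ of $A$ satisfies $|\lambda_i(1)-\theta_i|\le d_i\|E_i\|^2$. -/

import Mathlib

namespace RitzBound

section

variable {𝕜 : Type*} [RCLike 𝕜] {k m : ℕ}

/-- The Euclidean norm `‖E_i‖₂` of the `i`-th column of `E`. -/
noncomputable def colNorm (E : Matrix (Fin m) (Fin k) 𝕜) (i : Fin k) : ℝ :=
  ‖WithLp.toLp 2 (fun r => E r i)‖

/-- The matrix `[[Λ, E*], [E, A₂]]` with `Λ = diag(θ₁, …, θ_k)`. -/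
noncomputable def ritzMatrix (θ : Fin k → ℝ) (E : Matrix (Fin m) (Fin k) 𝕜)
    (A₂ : Matrix (Fin m) (Fin m) 𝕜) : Matrix (Fin k ⊕ Fin m) (Fin k ⊕ Fin m) 𝕜 :=
  Matrix.fromBlocks (Matrix.diagonal fun i => (θ i : 𝕜)) E.conjTranspose E A₂

/-- The block diagonal part `A₀ = [[Λ, 0], [0, A₂]]`. -/
noncomputable def diagPart (θ : Fin k → ℝ) (A₂ : Matrix (Fin m) (Fin m) 𝕜) :
    Matrix (Fin k ⊕ Fin m) (Fin k ⊕ Fin m) 𝕜 :=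
  Matrix.fromBlocks (Matrix.diagonal fun i => (θ i : 𝕜)) 0 0 A₂

/-- The off-diagonal matrix `[[0, G*], [G, 0]]`. -/
def offDiag (G : Matrix (Fin m) (Fin k) 𝕜) : Matrix (Fin k ⊕ Fin m) (Fin k ⊕ Fin m) 𝕜 :=
  Matrix.fromBlocks 0 G.conjTranspose G 0

/-- The matrix `F` for the index `i`: the off-diagonal matrix built from `[0, …, 0, E_i, 0, …, 0]`,
in which every column of `E` except the `i`-th is replaced by zero. -/
def colPart (E : Matrix (Fin m) (Fin k) 𝕜) (i : Fin k) :
    Matrix (Fin k ⊕ Fin m) (Fin k ⊕ Fin m) 𝕜 :=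
  offDiag (Matrix.of fun r j => if j = i then E r j else 0)

/-- The matrix `Ẽ` for the index `i`: the off-diagonal part of `A` without the `i`-th column,
`Ẽ = [[0, E*], [E, 0]] - F`. -/
def restPart (E : Matrix (Fin m) (Fin k) 𝕜) (i : Fin k) :
    Matrix (Fin k ⊕ Fin m) (Fin k ⊕ Fin m) 𝕜 :=
  offDiag E - colPart E i

/-- The matrix `A₀ + Ẽ + t F` for the index `i`. -/
noncomputable def pathMatrix (θ : Fin k → ℝ) (E : Matrix (Fin m) (Fin k) 𝕜)
    (A₂ : Matrix (Fin m) (Fin m) 𝕜) (i : Fin k) (t : ℝ) :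
    Matrix (Fin k ⊕ Fin m) (Fin k ⊕ Fin m) 𝕜 :=
  diagPart θ A₂ + restPart E i + (t : 𝕜) • colPart E i

/-- The real number `μ` is an eigenvalue of the square matrix `M`. -/
def IsEigenvalue {ι : Type*} [Fintype ι] [DecidableEq ι] (M : Matrix ι ι 𝕜) (μ : ℝ) : Prop :=
  Module.End.HasEigenvalue (Matrix.toLin' M) (μ : 𝕜)

/-- `p : [0, 1] → ℝ` is a continuous eigenvalue path of `A₀ + Ẽ + t F` that starts at `θ_i`. -/
def IsEigenPath (θ : Fin k → ℝ) (E : Matrix (Fin m) (Fin k) 𝕜)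
    (A₂ : Matrix (Fin m) (Fin m) 𝕜) (i : Fin k) (p : ℝ → ℝ) : Prop :=
  ContinuousOn p (Set.Icc 0 1) ∧ p 0 = θ i ∧
    ∀ t ∈ Set.Icc (0 : ℝ) 1, IsEigenvalue (pathMatrix θ E A₂ i t) (p t)

/-- `δ_i = min_j |θ_i - λ_j(A₂)| - ‖E_i‖₂`. -/
noncomputable def blockGap (θ : Fin k → ℝ) (E : Matrix (Fin m) (Fin k) 𝕜)
    {A₂ : Matrix (Fin m) (Fin m) 𝕜} (hA₂ : A₂.IsHermitian) (i : Fin k) : ℝ :=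
  (⨅ j : Fin m, |θ i - hA₂.eigenvalues j|) - colNorm E i

/-- `δ_{i,j} = |θ_i - θ_j| - ‖E_i‖₂`. -/
noncomputable def pairGap (θ : Fin k → ℝ) (E : Matrix (Fin m) (Fin k) 𝕜) (i j : Fin k) : ℝ :=
  |θ i - θ j| - colNorm E i

/-- `d_i = 1 / (δ_i - ∑_{j ≠ i} ‖E_j‖₂² / δ_{i,j})`, as a function of the numbers
`a = δ_i` and `b j = δ_{i,j}`. -/
noncomputable def gapCoeff (E : Matrix (Fin m) (Fin k) 𝕜) (i : Fin k) (a : ℝ) (b : Fin k → ℝ) :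
    ℝ :=
  1 / (a - ∑ j ∈ Finset.univ.erase i, colNorm E j ^ 2 / b j)

end

end RitzBound

/-! For an eigenvector `(u, v)` of `A` with eigenvalue `μ`, the block rows read `(μ - θ_j) u_j =
E_j* v` and `(A₂ - μ) v = -∑ u_j E_j`. Gaps for `μ` bound `‖v‖` from the second equation;
eliminating `u_j` for `j ≠ i` with the first gives `‖v‖ ≤ d_i ‖E_i‖ |u_i|`
(`gap_mul_norm_le_of_eigenvector`). So `u_i ≠ 0`, and row `i` yields `|μ - θ_i| ≤ d_i ‖E_i‖²`.

The same estimate makes `μ` simple: a repeated eigenvalue has an eigenvector with `u_i = 0`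
(`scaledEigenvalue_inj`). To obtain distinct eigenvalues, scale the columns of `E` and follow
ordered eigenvalues, which are continuous by Weyl. With column `i` off, `θ_i` stays a simple
eigenvalue while the other columns are switched on, so its index is constant
(`scaledEigenvalue_update_zero_eq`). Switching on column `i` moves it by at most `‖E_i‖`, the amount
subtracted in the gaps. A coincidence at the end would force equal indices, hence `θ_i = θ_j`. -/

open scoped InnerProductSpace

/-! ### Spectral estimates and Weyl's inequality -/

namespace LinearMap.IsSymmetric

variable {𝕜 V : Type*} [RCLike 𝕜] [NormedAddCommGroup V] [InnerProductSpace 𝕜 V]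
  [FiniteDimensional 𝕜 V] {n : ℕ} (hn : Module.finrank 𝕜 V = n) {T S : V →ₗ[𝕜] V}

theorem re_inner_apply_self_eq_sum (hT : T.IsSymmetric) (x : V) :
    RCLike.re ⟪T x, x⟫_𝕜 =
      ∑ l, hT.eigenvalues hn l * ‖(hT.eigenvectorBasis hn).repr x l‖ ^ 2 := by
  rw [← (hT.eigenvectorBasis hn).repr.inner_map_map, PiLp.inner_apply, map_sum]
  refine Finset.sum_congr rfl fun l _ => ?_
  rw [hT.eigenvectorBasis_apply_self_apply, RCLike.inner_apply, RingHom.map_mul, RCLike.conj_ofReal,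
    mul_left_comm, RCLike.mul_conj]
  norm_cast

theorem norm_sq_eq_sum_eigenvectorBasis (hT : T.IsSymmetric) (x : V) :
    ‖x‖ ^ 2 = ∑ l, ‖(hT.eigenvectorBasis hn).repr x l‖ ^ 2 := by
  rw [← (hT.eigenvectorBasis hn).repr.norm_map, EuclideanSpace.norm_sq_eq]

/-- If every point of the spectrum of `T` has distance at least `a` from `μ`, then `T - μ` is
bounded below by `a`. -/
theorem mul_norm_le_norm_apply_sub_smul (hT : T.IsSymmetric) {a μ : ℝ} (ha : 0 ≤ a)
    (h : ∀ l, a ≤ |μ - hT.eigenvalues hn l|) (x : V) :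
    a * ‖x‖ ≤ ‖T x - (μ : 𝕜) • x‖ := by
  refine le_of_sq_le_sq ?_ (norm_nonneg _)
  rw [mul_pow, norm_sq_eq_sum_eigenvectorBasis hn hT x,
    norm_sq_eq_sum_eigenvectorBasis hn hT (T x - _), Finset.mul_sum]
  refine Finset.sum_le_sum fun l _ => ?_
  have : (hT.eigenvectorBasis hn).repr (T x - (μ : 𝕜) • x) l
      = ((hT.eigenvalues hn l - μ : ℝ) : 𝕜) * (hT.eigenvectorBasis hn).repr x l := by
    rw [map_sub, map_smul, PiLp.sub_apply, PiLp.smul_apply, hT.eigenvectorBasis_apply_self_apply,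
      smul_eq_mul, RCLike.ofReal_sub, sub_mul]
  rw [this, norm_mul, mul_pow, RCLike.norm_ofReal, abs_sub_comm]
  gcongr
  exact h l

/-- Weyl's monotonicity principle for the ordered eigenvalues of symmetric operators. -/
theorem eigenvalues_le_eigenvalues_add (hT : T.IsSymmetric) (hS : S.IsSymmetric) {c : ℝ}
    (h : ∀ x, RCLike.re ⟪T x, x⟫_𝕜 ≤ RCLike.re ⟪S x, x⟫_𝕜 + c * ‖x‖ ^ 2) (j : Fin n) :
    hT.eigenvalues hn j ≤ hS.eigenvalues hn j + c := by
  -- The `n - 1` conditions leave a nonzero vector in the span of the `T`-eigenvectors of index `≤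
  -- j` and of the `S`-eigenvectors of index `≥ j`.
  let f : V →ₗ[𝕜] ({l : Fin n // l ≠ j} → 𝕜) := LinearMap.pi fun l =>
    if j < l.1 then (hT.eigenvectorBasis hn).toBasis.coord l.1
    else (hS.eigenvectorBasis hn).toBasis.coord l.1
  have hker : LinearMap.ker f ≠ ⊥ := by
    apply LinearMap.ker_ne_bot_of_finrank_lt
    rw [Module.finrank_fintype_fun_eq_card, hn, Fintype.card_subtype_compl, Fintype.card_fin,
      Fintype.card_unique]
    have := j.2
    omega
  obtain ⟨x, hx, hx0⟩ := Submodule.exists_mem_ne_zero_of_ne_bot hker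
  have hf (l : Fin n) (hl : l ≠ j) : f x ⟨l, hl⟩ = 0 := congrFun (LinearMap.mem_ker.1 hx) _
  have hT0 (l : Fin n) (hl : j < l) : (hT.eigenvectorBasis hn).repr x l = 0 := by
    simpa [f, hl] using hf l hl.ne'
  have hS0 (l : Fin n) (hl : l < j) : (hS.eigenvectorBasis hn).repr x l = 0 := by
    simpa [f, hl.not_gt] using hf l hl.ne
  have h1 : hT.eigenvalues hn j * ‖x‖ ^ 2 ≤ RCLike.re ⟪T x, x⟫_𝕜 := by
    rw [re_inner_apply_self_eq_sum hn hT, norm_sq_eq_sum_eigenvectorBasis hn hT, Finset.mul_sum]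
    refine Finset.sum_le_sum fun l _ => ?_
    rcases lt_or_ge j l with hl | hl
    · simp [hT0 l hl]
    · exact mul_le_mul_of_nonneg_right (hT.eigenvalues_antitone hn hl) (sq_nonneg _)
  have h2 : RCLike.re ⟪S x, x⟫_𝕜 ≤ hS.eigenvalues hn j * ‖x‖ ^ 2 := by
    rw [re_inner_apply_self_eq_sum hn hS, norm_sq_eq_sum_eigenvectorBasis hn hS, Finset.mul_sum]
    refine Finset.sum_le_sum fun l _ => ?_
    rcases lt_or_ge l j with hl | hl
    · simp [hS0 l hl]
    · exact mul_le_mul_of_nonneg_right (hS.eigenvalues_antitone hn hl) (sq_nonneg _)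
  have hpos : 0 < ‖x‖ ^ 2 := by positivity
  refine le_of_mul_le_mul_right ?_ hpos
  linarith [h x]

end LinearMap.IsSymmetric

namespace RitzBound

open Matrix

/-! ### Ordered eigenvalues of Hermitian matrices -/

section Hermitian

variable {𝕜 ι : Type*} [RCLike 𝕜] [Fintype ι] [DecidableEq ι] {A B : Matrix ι ι 𝕜}

theorem abs_eigenvalues₀_sub_le (hA : A.IsHermitian) (hB : B.IsHermitian) {c : ℝ}
    (h : ∀ x, |RCLike.re ⟪toEuclideanLin (A - B) x, x⟫_𝕜| ≤ c * ‖x‖ ^ 2)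
    (r : Fin (Fintype.card ι)) : |hA.eigenvalues₀ r - hB.eigenvalues₀ r| ≤ c := by
  have h' (x) : |RCLike.re ⟪toEuclideanLin A x, x⟫_𝕜 - RCLike.re ⟪toEuclideanLin B x, x⟫_𝕜|
      ≤ c * ‖x‖ ^ 2 := by
    simpa only [map_sub, LinearMap.sub_apply, inner_sub_left] using h x
  rw [abs_sub_le_iff, sub_le_iff_le_add', sub_le_iff_le_add']
  constructor <;> refine LinearMap.IsSymmetric.eigenvalues_le_eigenvalues_add _ _ _ (fun x => ?_) r
  · linarith [(abs_le.1 (h' x)).2]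
  · linarith [(abs_le.1 (h' x)).1]

theorem isEigenvalue_iff_exists_mulVec (μ : ℝ) :
    IsEigenvalue A μ ↔ ∃ x : ι → 𝕜, x ≠ 0 ∧ A *ᵥ x = (μ : 𝕜) • x := by
  constructor
  · intro h
    obtain ⟨x, hx⟩ := h.exists_hasEigenvector
    exact ⟨x, hx.2, hx.apply_eq_smul⟩
  · rintro ⟨x, hx, h⟩
    exact Module.End.hasEigenvalue_of_hasEigenvector (x := x)
      (Module.End.hasEigenvector_iff.2 ⟨Module.End.mem_eigenspace_iff.2 h, hx⟩)

theorem isEigenvalue_iff_exists_eigenvalues₀ (hA : A.IsHermitian) (μ : ℝ) :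
    IsEigenvalue A μ ↔ ∃ r, hA.eigenvalues₀ r = μ := by
  rw [IsEigenvalue, Module.End.hasEigenvalue_iff_mem_spectrum, spectrum_toLin',
    hA.spectrum_eq_image_range]
  simp only [Set.mem_image, Set.mem_range, RCLike.ofReal_inj]
  constructor
  · rintro ⟨_, ⟨i, rfl⟩, rfl⟩
    exact ⟨_, rfl⟩
  · rintro ⟨r, rfl⟩
    exact ⟨_, ⟨Fintype.equivOfCardEq (Fintype.card_fin _) r, rfl⟩, by
      simp [IsHermitian.eigenvalues]⟩

/-- A repeated eigenvalue has an eigenvector that vanishes at any given coordinate. -/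
theorem exists_eigenvector_apply_eq_zero (hA : A.IsHermitian) {r s : Fin (Fintype.card ι)}
    (hrs : r ≠ s) (h : hA.eigenvalues₀ r = hA.eigenvalues₀ s) (i : ι) :
    ∃ x : ι → 𝕜, x ≠ 0 ∧ A *ᵥ x = (hA.eigenvalues₀ r : 𝕜) • x ∧ x i = 0 := by
  set e : Fin (Fintype.card ι) ≃ ι := Fintype.equivOfCardEq (Fintype.card_fin _) with he
  have hev (r) : A *ᵥ ⇑(hA.eigenvectorBasis (e r))
      = (hA.eigenvalues₀ r : 𝕜) • ⇑(hA.eigenvectorBasis (e r)) := by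
    rw [hA.mulVec_eigenvectorBasis, RCLike.real_smul_eq_coe_smul (K := 𝕜)]
    simp [IsHermitian.eigenvalues, he]
  set y := hA.eigenvectorBasis (e r)
  set z := hA.eigenvectorBasis (e s)
  by_cases hyi : y i = 0
  · refine ⟨y, fun h0 => ?_, hev r, hyi⟩
    exact hA.eigenvectorBasis.orthonormal.ne_zero (e r) (by ext l; exact congrFun h0 l)
  -- This combination cancels coordinate `i`; pairing it with `z` shows that it is nonzero.
  · refine ⟨z i • ⇑y - y i • ⇑z, fun h0 => hyi ?_, ?_, by simp [mul_comm]⟩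
    · have h1 : z i • y - y i • z = 0 := by ext l; exact congrFun h0 l
      have h2 := congrArg (fun w => ⟪z, w⟫_𝕜) h1
      have hzy : ⟪z, y⟫_𝕜 = 0 := hA.eigenvectorBasis.inner_eq_zero (by simpa using hrs.symm)
      have hz0 : z ≠ 0 := hA.eigenvectorBasis.orthonormal.ne_zero _
      simpa [inner_sub_right, inner_smul_right, hzy, hz0] using h2
    · rw [mulVec_sub, mulVec_smul, mulVec_smul, hev r, hev s, ← h, smul_sub, smul_comm (z i),
        smul_comm (y i)]

end Hermitian

/-! ### Eigenvector estimates for the Ritz matrix -/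

section Ritz

variable {𝕜 : Type*} [RCLike 𝕜] {k m : ℕ} (θ : Fin k → ℝ) (E : Matrix (Fin m) (Fin k) 𝕜)
  {A₂ : Matrix (Fin m) (Fin m) 𝕜}

theorem ritzMatrix_isHermitian (hA₂ : A₂.IsHermitian) : (ritzMatrix θ E A₂).IsHermitian := by
  refine IsHermitian.fromBlocks ?_ (conjTranspose_conjTranspose E) hA₂
  exact isHermitian_diagonal_of_self_adjoint _ (by ext i; simp)

theorem ritzMatrix_sub (E' : Matrix (Fin m) (Fin k) 𝕜) :
    ritzMatrix θ E A₂ - ritzMatrix θ E' A₂ = offDiag (E - E') := by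
  ext (i | i) (j | j) <;> simp [ritzMatrix, offDiag]

theorem colNorm_nonneg (j : Fin k) : 0 ≤ colNorm E j := norm_nonneg _

theorem conjTranspose_mulVec_apply_eq_inner (v : Fin m → 𝕜) (j : Fin k) :
    (Eᴴ *ᵥ v) j = ⟪WithLp.toLp 2 (fun r => E r j), WithLp.toLp 2 v⟫_𝕜 := by
  simp [mulVec, dotProduct, PiLp.inner_apply, mul_comm]

theorem norm_sq_toLp_sum (x : Fin k ⊕ Fin m → 𝕜) :
    ‖WithLp.toLp 2 x‖ ^ 2 =
      ∑ j, ‖x (Sum.inl j)‖ ^ 2 + ‖WithLp.toLp 2 (x ∘ Sum.inr)‖ ^ 2 := by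
  simp [EuclideanSpace.norm_sq_eq]

/-- Column `j` contributes at most `2 |u_j| ‖E_j‖ ‖v‖ ≤ ‖E_j‖ ‖x‖²`. A single nonzero column thus
gives the constant `‖E_i‖`. -/
theorem abs_re_inner_offDiag_le (x : EuclideanSpace 𝕜 (Fin k ⊕ Fin m)) :
    |RCLike.re ⟪toEuclideanLin (offDiag E) x, x⟫_𝕜| ≤ (∑ j, colNorm E j) * ‖x‖ ^ 2 := by
  obtain ⟨x, rfl⟩ := WithLp.toLp_surjective 2 x
  set u := x ∘ Sum.inl
  set v := x ∘ Sum.inr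
  have hx : x = Sum.elim u v := (Sum.elim_comp_inl_inr x).symm
  have hform : RCLike.re ⟪toEuclideanLin (offDiag E) (WithLp.toLp 2 x), WithLp.toLp 2 x⟫_𝕜
      = ∑ j, 2 * RCLike.re (u j * star ((Eᴴ *ᵥ v) j)) := by
    have h1 : ⟪toEuclideanLin (offDiag E) (WithLp.toLp 2 x), WithLp.toLp 2 x⟫_𝕜
        = u ⬝ᵥ star (Eᴴ *ᵥ v) + v ⬝ᵥ star (E *ᵥ u) := by
      rw [toLpLin_toLp, EuclideanSpace.inner_toLp_toLp, toLin'_apply, hx, offDiag, fromBlocks_mulVec]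
      simp [dotProduct]
    have h2 : v ⬝ᵥ star (E *ᵥ u) = star (u ⬝ᵥ star (Eᴴ *ᵥ v)) := by
      rw [← star_dotProduct_star, star_star, star_mulVec, dotProduct_comm, ← dotProduct_mulVec,
        dotProduct_comm]
    rw [h1, h2, map_add, RCLike.star_def, RCLike.conj_re, ← two_mul, dotProduct, map_sum,
      Finset.mul_sum]
    rfl
  rw [hform, Finset.sum_mul]
  refine (Finset.abs_sum_le_sum_abs _ _).trans (Finset.sum_le_sum fun j _ => ?_)
  have hw : ‖(Eᴴ *ᵥ v) j‖ ≤ colNorm E j * ‖WithLp.toLp 2 v‖ := by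
    rw [conjTranspose_mulVec_apply_eq_inner]
    exact norm_inner_le_norm _ _
  have hnorm : ‖u j‖ ^ 2 + ‖WithLp.toLp 2 v‖ ^ 2 ≤ ‖WithLp.toLp 2 x‖ ^ 2 := by
    rw [norm_sq_toLp_sum x]
    gcongr
    exact Finset.single_le_sum (f := fun j => ‖u j‖ ^ 2) (fun _ _ => sq_nonneg _)
      (Finset.mem_univ j)
  calc |2 * RCLike.re (u j * star ((Eᴴ *ᵥ v) j))|
      ≤ 2 * (‖u j‖ * ‖(Eᴴ *ᵥ v) j‖) := by
        rw [abs_mul, abs_two, ← norm_star ((Eᴴ *ᵥ v) j), ← norm_mul]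
        gcongr
        exact RCLike.abs_re_le_norm _
    _ ≤ 2 * (‖u j‖ * (colNorm E j * ‖WithLp.toLp 2 v‖)) := by gcongr
    _ = colNorm E j * (2 * ‖u j‖ * ‖WithLp.toLp 2 v‖) := by ring
    _ ≤ colNorm E j * ‖WithLp.toLp 2 x‖ ^ 2 := by
        refine mul_le_mul_of_nonneg_left ?_ (colNorm_nonneg E j)
        exact (two_mul_le_add_sq _ _).trans hnorm

theorem abs_eigenvalues₀_ritzMatrix_sub_le (hA₂ : A₂.IsHermitian)
    (E' : Matrix (Fin m) (Fin k) 𝕜) (r : Fin (Fintype.card (Fin k ⊕ Fin m))) :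
    |(ritzMatrix_isHermitian θ E hA₂).eigenvalues₀ r
      - (ritzMatrix_isHermitian θ E' hA₂).eigenvalues₀ r| ≤ ∑ j, colNorm (E - E') j :=
  abs_eigenvalues₀_sub_le _ _
    (fun x => by rw [ritzMatrix_sub]; exact abs_re_inner_offDiag_le _ x) r

variable {θ E}

theorem conjTranspose_mulVec_of_eigenvector {μ : ℝ} {x : Fin k ⊕ Fin m → 𝕜}
    (hx : ritzMatrix θ E A₂ *ᵥ x = (μ : 𝕜) • x) (j : Fin k) :
    (Eᴴ *ᵥ (x ∘ Sum.inr)) j = ((μ - θ j : ℝ) : 𝕜) * x (Sum.inl j) := by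
  have h := congrFun hx (Sum.inl j)
  rw [ritzMatrix, fromBlocks_mulVec, Sum.elim_inl, Pi.add_apply, mulVec_diagonal] at h
  simp only [Function.comp_apply, Pi.smul_apply, smul_eq_mul] at h
  push_cast
  linear_combination h

theorem sum_smul_col_of_eigenvector {μ : ℝ} {x : Fin k ⊕ Fin m → 𝕜}
    (hx : ritzMatrix θ E A₂ *ᵥ x = (μ : 𝕜) • x) :
    toEuclideanLin A₂ (WithLp.toLp 2 (x ∘ Sum.inr)) - (μ : 𝕜) • WithLp.toLp 2 (x ∘ Sum.inr)
      = -∑ j, x (Sum.inl j) • WithLp.toLp 2 (fun r => E r j) := by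
  ext r
  have h := congrFun hx (Sum.inr r)
  rw [ritzMatrix, fromBlocks_mulVec, Sum.elim_inr, Pi.add_apply] at h
  have hE : (E *ᵥ (x ∘ Sum.inl)) r = ∑ j, x (Sum.inl j) * E r j := by
    simp [mulVec, dotProduct, mul_comm]
  simp only [Pi.smul_apply, smul_eq_mul, hE] at h
  simp only [toLpLin_toLp, toLin'_apply, PiLp.sub_apply, PiLp.smul_apply, PiLp.neg_apply,
    WithLp.ofLp_sum, Finset.sum_apply, WithLp.ofLp_smul, Pi.smul_apply, smul_eq_mul,
    Function.comp_apply]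
  linear_combination h

theorem norm_sub_mul_norm_le_of_eigenvector {μ : ℝ} {x : Fin k ⊕ Fin m → 𝕜}
    (hx : ritzMatrix θ E A₂ *ᵥ x = (μ : 𝕜) • x) (j : Fin k) :
    |μ - θ j| * ‖x (Sum.inl j)‖ ≤ colNorm E j * ‖WithLp.toLp 2 (x ∘ Sum.inr)‖ := by
  rw [← RCLike.norm_ofReal (K := 𝕜), ← norm_mul, ← conjTranspose_mulVec_of_eigenvector hx,
    conjTranspose_mulVec_apply_eq_inner]
  exact norm_inner_le_norm _ _

/-- In an eigenvector of the Ritz matrix, the lower block is controlled by the `i`-th entry as soon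
as the eigenvalue is separated from the spectrum of `A₂` and from the other Ritz values. -/
theorem gap_mul_norm_le_of_eigenvector (hA₂ : A₂.IsHermitian) {μ a : ℝ} {b : Fin k → ℝ}
    {i : Fin k} (ha : 0 ≤ a) (hμa : ∀ j, a ≤ |μ - hA₂.eigenvalues j|)
    (hμb : ∀ j, j ≠ i → 0 < b j ∧ b j ≤ |μ - θ j|) {x : Fin k ⊕ Fin m → 𝕜}
    (hx : ritzMatrix θ E A₂ *ᵥ x = (μ : 𝕜) • x) :
    (a - ∑ j ∈ Finset.univ.erase i, colNorm E j ^ 2 / b j) * ‖WithLp.toLp 2 (x ∘ Sum.inr)‖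
      ≤ colNorm E i * ‖x (Sum.inl i)‖ := by
  set v := WithLp.toLp 2 (x ∘ Sum.inr) with hv
  have h1 : a * ‖v‖ ≤ ∑ j, colNorm E j * ‖x (Sum.inl j)‖ := by
    have hlow : a * ‖v‖ ≤ ‖toEuclideanLin A₂ v - (μ : 𝕜) • v‖ := by
      refine LinearMap.IsSymmetric.mul_norm_le_norm_apply_sub_smul finrank_euclideanSpace
        (isSymmetric_toEuclideanLin_iff.mpr hA₂) ha (fun l => ?_) v
      have := hμa (Fintype.equivOfCardEq (Fintype.card_fin _) l)
      rwa [IsHermitian.eigenvalues, Equiv.symm_apply_apply] at this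
    refine hlow.trans ?_
    rw [hv, sum_smul_col_of_eigenvector hx, norm_neg]
    refine (norm_sum_le _ _).trans (Finset.sum_le_sum fun j _ => ?_)
    rw [norm_smul, mul_comm]
    rfl
  have h2 (j : Fin k) (hj : j ≠ i) :
      colNorm E j * ‖x (Sum.inl j)‖ ≤ colNorm E j ^ 2 / b j * ‖v‖ := by
    obtain ⟨hb, hbμ⟩ := hμb j hj
    rw [div_mul_eq_mul_div, le_div_iff₀ hb, sq, mul_assoc, mul_assoc]
    refine mul_le_mul_of_nonneg_left ?_ (colNorm_nonneg E j)
    rw [mul_comm]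
    exact (mul_le_mul_of_nonneg_right hbμ (norm_nonneg _)).trans
      (norm_sub_mul_norm_le_of_eigenvector hx j)
  rw [← Finset.add_sum_erase _ _ (Finset.mem_univ i)] at h1
  have h3 := Finset.sum_le_sum (s := Finset.univ.erase i) fun j hj =>
    h2 j (Finset.ne_of_mem_erase hj)
  rw [← Finset.sum_mul] at h3
  linarith

/-- The gap estimate first kills the lower block; then each other row gives `(μ - θ_j) u_j = 0` with
`μ ≠ θ_j`. -/
theorem eigenvector_eq_zero_of_apply_eq_zero (hA₂ : A₂.IsHermitian) {μ a : ℝ} {b : Fin k → ℝ}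
    {i : Fin k} (ha : 0 ≤ a) (hμa : ∀ j, a ≤ |μ - hA₂.eigenvalues j|)
    (hμb : ∀ j, j ≠ i → 0 < b j ∧ b j ≤ |μ - θ j|)
    (hd : 0 < a - ∑ j ∈ Finset.univ.erase i, colNorm E j ^ 2 / b j) {x : Fin k ⊕ Fin m → 𝕜}
    (hx : ritzMatrix θ E A₂ *ᵥ x = (μ : 𝕜) • x) (hxi : x (Sum.inl i) = 0) : x = 0 := by
  have h := gap_mul_norm_le_of_eigenvector hA₂ ha hμa hμb hx
  rw [hxi, norm_zero, mul_zero] at h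
  have hv : WithLp.toLp 2 (x ∘ Sum.inr) = 0 :=
    norm_le_zero_iff.1 (nonpos_of_mul_nonpos_right h hd)
  ext (j | r)
  · by_cases hj : j = i
    · rw [hj, hxi, Pi.zero_apply]
    · have h' := norm_sub_mul_norm_le_of_eigenvector hx j
      rw [hv, norm_zero, mul_zero] at h'
      obtain ⟨hb, hbμ⟩ := hμb j hj
      exact norm_le_zero_iff.1 (nonpos_of_mul_nonpos_right h' (hb.trans_le hbμ))
  · exact congrArg (fun w => w.ofLp r) hv

theorem gapCoeff_pos_iff {a : ℝ} {b : Fin k → ℝ} {i : Fin k} :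
    0 < gapCoeff E i a b ↔ 0 < a - ∑ j ∈ Finset.univ.erase i, colNorm E j ^ 2 / b j :=
  one_div_pos

theorem abs_sub_le_gapCoeff_mul (hA₂ : A₂.IsHermitian) {μ a : ℝ} {b : Fin k → ℝ}
    {i : Fin k} (ha : 0 ≤ a) (hμa : ∀ j, a ≤ |μ - hA₂.eigenvalues j|)
    (hμb : ∀ j, j ≠ i → 0 < b j ∧ b j ≤ |μ - θ j|) (hd : 0 < gapCoeff E i a b)
    (hμ : IsEigenvalue (ritzMatrix θ E A₂) μ) :
    |μ - θ i| ≤ gapCoeff E i a b * colNorm E i ^ 2 := by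
  rw [gapCoeff_pos_iff] at hd
  obtain ⟨x, hx0, hx⟩ := (isEigenvalue_iff_exists_mulVec μ).1 hμ
  have hxi : x (Sum.inl i) ≠ 0 := fun h =>
    hx0 (eigenvector_eq_zero_of_apply_eq_zero hA₂ ha hμa hμb hd hx h)
  have h1 := gap_mul_norm_le_of_eigenvector hA₂ ha hμa hμb hx
  have h2 := norm_sub_mul_norm_le_of_eigenvector hx i
  rw [gapCoeff, one_div_mul_eq_div, le_div_iff₀ hd]
  refine le_of_mul_le_mul_right ?_ (norm_pos_iff.2 hxi)
  have h3 := mul_le_mul_of_nonneg_right h2 hd.le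
  have h4 := mul_le_mul_of_nonneg_left h1 (colNorm_nonneg E i)
  linarith

end Ritz

/-! ### Scaling the columns and following eigenvalues -/

section Scaling

variable {𝕜 : Type*} [RCLike 𝕜] {k m : ℕ} (θ : Fin k → ℝ) (E : Matrix (Fin m) (Fin k) 𝕜)
  {A₂ : Matrix (Fin m) (Fin m) 𝕜}

/-- The matrix `E` with its `j`-th column multiplied by the real number `c j`. -/
noncomputable def scaleCols (c : Fin k → ℝ) : Matrix (Fin m) (Fin k) 𝕜 :=
  Matrix.of fun r j => (c j : 𝕜) * E r j

theorem scaleCols_one : scaleCols E 1 = E := by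
  ext; simp [scaleCols]

theorem colNorm_scaleCols (c : Fin k → ℝ) (j : Fin k) :
    colNorm (scaleCols E c) j = |c j| * colNorm E j := by
  rw [colNorm, colNorm, ← RCLike.norm_ofReal (K := 𝕜), ← norm_smul]
  rfl

theorem scaleCols_sub (c c' : Fin k → ℝ) :
    scaleCols E c - scaleCols E c' = scaleCols E (c - c') := by
  ext; simp [scaleCols, sub_mul]

theorem pathMatrix_eq_ritzMatrix (i : Fin k) (t : ℝ) :
    pathMatrix θ E A₂ i t = ritzMatrix θ (scaleCols E (Function.update 1 i t)) A₂ := by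
  ext (a | a) (b | b)
  · simp [pathMatrix, diagPart, restPart, colPart, offDiag, ritzMatrix]
  · by_cases h : a = i <;>
      simp [pathMatrix, diagPart, restPart, colPart, offDiag, ritzMatrix, scaleCols, h,
        RCLike.real_smul_eq_coe_mul]
  · by_cases h : b = i <;>
      simp [pathMatrix, diagPart, restPart, colPart, offDiag, ritzMatrix, scaleCols, h,
        RCLike.real_smul_eq_coe_mul]
  · simp [pathMatrix, diagPart, restPart, colPart, offDiag, ritzMatrix]

/-- The `r`-th largest eigenvalue of the Ritz matrix with the columns of `E` scaled by `c`. -/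
noncomputable def scaledEigenvalue (hA₂ : A₂.IsHermitian) (c : Fin k → ℝ)
    (r : Fin (Fintype.card (Fin k ⊕ Fin m))) : ℝ :=
  (ritzMatrix_isHermitian θ (scaleCols E c) hA₂).eigenvalues₀ r

theorem isEigenvalue_scaledEigenvalue (hA₂ : A₂.IsHermitian) (c : Fin k → ℝ)
    (r : Fin (Fintype.card (Fin k ⊕ Fin m))) :
    IsEigenvalue (ritzMatrix θ (scaleCols E c) A₂) (scaledEigenvalue θ E hA₂ c r) :=
  (isEigenvalue_iff_exists_eigenvalues₀ (ritzMatrix_isHermitian θ _ hA₂) _).2 ⟨r, rfl⟩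

theorem abs_scaledEigenvalue_sub_le (hA₂ : A₂.IsHermitian) (c c' : Fin k → ℝ)
    (r : Fin (Fintype.card (Fin k ⊕ Fin m))) :
    |scaledEigenvalue θ E hA₂ c r - scaledEigenvalue θ E hA₂ c' r|
      ≤ ∑ j, |c j - c' j| * colNorm E j := by
  refine (abs_eigenvalues₀_ritzMatrix_sub_le θ _ hA₂ _ r).trans_eq ?_
  simp only [scaleCols_sub, colNorm_scaleCols, Pi.sub_apply]

theorem continuous_scaledEigenvalue (hA₂ : A₂.IsHermitian)
    (r : Fin (Fintype.card (Fin k ⊕ Fin m))) :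
    Continuous fun c => scaledEigenvalue θ E hA₂ c r := by
  refine continuous_iff_continuousAt.2 fun c => tendsto_iff_dist_tendsto_zero.2 ?_
  refine squeeze_zero (fun _ => dist_nonneg)
    (fun c' => abs_scaledEigenvalue_sub_le θ E hA₂ c' c r) ?_
  have : Continuous fun c' : Fin k → ℝ => ∑ j, |c' j - c j| * colNorm E j := by fun_prop
  simpa using this.tendsto c

/-- If the `i`-th column is scaled to zero, then `θ i` is an eigenvalue. -/
theorem exists_scaledEigenvalue_eq (hA₂ : A₂.IsHermitian) {c : Fin k → ℝ} {i : Fin k}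
    (hc : c i = 0) : ∃ r, scaledEigenvalue θ E hA₂ c r = θ i := by
  refine (isEigenvalue_iff_exists_eigenvalues₀ (ritzMatrix_isHermitian θ _ hA₂) _).1
    ((isEigenvalue_iff_exists_mulVec _).2 ⟨Pi.single (Sum.inl i) 1, by simp, ?_⟩)
  ext (j | r)
  · by_cases h : j = i
    · subst h; simp [ritzMatrix]
    · simp [ritzMatrix, h]
  · simp [ritzMatrix, scaleCols, hc]

theorem isEigenPath_scaledEigenvalue (hA₂ : A₂.IsHermitian) {i : Fin k}
    {r : Fin (Fintype.card (Fin k ⊕ Fin m))}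
    (h0 : scaledEigenvalue θ E hA₂ (Function.update 1 i 0) r = θ i) :
    IsEigenPath θ E A₂ i fun t => scaledEigenvalue θ E hA₂ (Function.update 1 i t) r := by
  refine ⟨Continuous.continuousOn ?_, h0, fun t _ => ?_⟩
  · exact (continuous_scaledEigenvalue θ E hA₂ r).comp
      (continuous_const.update i continuous_id)
  · rw [pathMatrix_eq_ritzMatrix]
    exact isEigenvalue_scaledEigenvalue θ E hA₂ _ r

variable {θ E} {hA₂ : A₂.IsHermitian} {i : Fin k}

theorem blockGap_le_abs_sub {μ : ℝ} (hμ : |μ - θ i| ≤ colNorm E i) (j : Fin m) :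
    blockGap θ E hA₂ i ≤ |μ - hA₂.eigenvalues j| := by
  have h1 : (⨅ j : Fin m, |θ i - hA₂.eigenvalues j|) ≤ |θ i - hA₂.eigenvalues j| :=
    ciInf_le (Set.finite_range _).bddBelow j
  have h2 := abs_sub_le (θ i) μ (hA₂.eigenvalues j)
  rw [abs_sub_comm (θ i) μ] at h2
  rw [blockGap]
  linarith

theorem pairGap_le_abs_sub {μ : ℝ} (hμ : |μ - θ i| ≤ colNorm E i) (j : Fin k) :
    pairGap θ E i j ≤ |μ - θ j| := by
  have h2 := abs_sub_le (θ i) μ (θ j)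
  rw [abs_sub_comm (θ i) μ] at h2
  rw [pairGap]
  linarith

/-- Simplicity near `θ i`: a second index would give an eigenvector vanishing at coordinate `i`. -/
theorem scaledEigenvalue_inj (ha : 0 < blockGap θ E hA₂ i)
    (hb : ∀ j, j ≠ i → 0 < pairGap θ E i j)
    (hd : 0 < gapCoeff E i (blockGap θ E hA₂ i) (pairGap θ E i)) {c : Fin k → ℝ}
    (hc : ∀ j, j ≠ i → |c j| ≤ 1) {r s : Fin (Fintype.card (Fin k ⊕ Fin m))}
    (hr : |scaledEigenvalue θ E hA₂ c r - θ i| ≤ colNorm E i)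
    (hrs : scaledEigenvalue θ E hA₂ c r = scaledEigenvalue θ E hA₂ c s) : r = s := by
  by_contra hne
  obtain ⟨x, hx0, hx, hxi⟩ := exists_eigenvector_apply_eq_zero
    (ritzMatrix_isHermitian θ (scaleCols E c) hA₂) hne hrs (Sum.inl i)
  refine hx0 (eigenvector_eq_zero_of_apply_eq_zero hA₂ ha.le (blockGap_le_abs_sub hr)
    (fun j hj => ⟨hb j hj, pairGap_le_abs_sub hr j⟩) ?_ hx hxi)
  -- Shrinking the columns other than `i` only enlarges the denominator of `d_i`.
  refine (gapCoeff_pos_iff.1 hd).trans_le (sub_le_sub_left (Finset.sum_le_sum fun j hj => ?_) _)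
  have hj := Finset.ne_of_mem_erase hj
  refine div_le_div_of_nonneg_right ?_ (hb j hj).le
  rw [colNorm_scaleCols, mul_pow]
  exact mul_le_of_le_one_left (sq_nonneg _) (pow_le_one₀ (abs_nonneg _) (hc j hj))

/-- Under the gap conditions, switching on all columns of `E` except the `i`-th one does not change
the position of `θ i` among the ordered eigenvalues. -/
theorem scaledEigenvalue_update_zero_eq (ha : 0 < blockGap θ E hA₂ i)
    (hb : ∀ j, j ≠ i → 0 < pairGap θ E i j)
    (hd : 0 < gapCoeff E i (blockGap θ E hA₂ i) (pairGap θ E i))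
    {r : Fin (Fintype.card (Fin k ⊕ Fin m))} (hr : scaledEigenvalue θ E hA₂ 0 r = θ i) :
    scaledEigenvalue θ E hA₂ (Function.update 1 i 0) r = θ i := by
  let c (s : unitInterval) : Fin k → ℝ := Function.update (fun _ => (s : ℝ)) i 0
  have hcont (r) : Continuous fun s => scaledEigenvalue θ E hA₂ (c s) r :=
    (continuous_scaledEigenvalue θ E hA₂ r).comp
      ((continuous_pi fun _ => continuous_subtype_val).update i continuous_const)
  let U (r) : Set unitInterval := {s | scaledEigenvalue θ E hA₂ (c s) r = θ i}
  have hclosed (r) : IsClosed (U r) := isClosed_eq (hcont r) continuous_const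
  -- At each `s` exactly one index carries the value `θ i`, so the finitely many closed sets `U q`
  -- partition the interval; each is clopen, hence empty or everything.
  have hcompl : (U r)ᶜ = ⋃ q ∈ {q | q ≠ r}, U q := by
    ext s
    simp only [Set.mem_compl_iff, Set.mem_iUnion, Set.mem_ofPred_eq, exists_prop, U]
    constructor
    · intro h
      obtain ⟨q, hq⟩ := exists_scaledEigenvalue_eq θ E hA₂ (c := c s) (i := i) (by simp [c])
      exact ⟨q, fun h' => h (h' ▸ hq), hq⟩
    · rintro ⟨q, hqr, hq⟩ h
      refine hqr (scaledEigenvalue_inj ha hb hd (c := c s) (fun j hj => ?_) ?_ (hq.trans h.symm))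
      · simpa [c, hj, abs_of_nonneg s.2.1] using s.2.2
      · simpa [hq] using colNorm_nonneg E i
  have hclopen : IsClopen (U r) := by
    refine ⟨hclosed r, isClosed_compl_iff.1 ?_⟩
    rw [hcompl]
    exact (Set.toFinite _).isClosed_biUnion fun q _ => hclosed q
  have huniv : U r = Set.univ := hclopen.eq_univ ⟨0, by
    have : c 0 = 0 := by simp [c, ← Pi.zero_def]
    simpa [U, this] using hr⟩
  have h1 : (1 : unitInterval) ∈ U r := huniv ▸ Set.mem_univ _
  have hc1 : c 1 = Function.update (1 : Fin k → ℝ) i 0 := rfl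
  rwa [Set.mem_ofPred_eq, hc1] at h1

theorem abs_scaledEigenvalue_one_sub_le {r : Fin (Fintype.card (Fin k ⊕ Fin m))}
    (h0 : scaledEigenvalue θ E hA₂ (Function.update 1 i 0) r = θ i) :
    |scaledEigenvalue θ E hA₂ 1 r - θ i| ≤ colNorm E i := by
  rw [← h0]
  refine (abs_scaledEigenvalue_sub_le θ E hA₂ _ _ r).trans_eq ?_
  rw [Finset.sum_eq_single i]
  · simp
  · intro j _ hj
    simp [hj]
  · simp

end Scaling

end RitzBound

theorem theorem1 {𝕜 : Type*} [RCLike 𝕜] {k m : ℕ} (θ : Fin k → ℝ)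
    (E : Matrix (Fin m) (Fin k) 𝕜) (A₂ : Matrix (Fin m) (Fin m) 𝕜) (hA₂ : A₂.IsHermitian) :
    -- eigenvalue paths that start at the Ritz values exist
    (∀ i, ∃ p : ℝ → ℝ, RitzBound.IsEigenPath θ E A₂ i p) ∧
    -- the bound with the explicit gaps, and the one-to-one correspondence
    (∀ S : Set (Fin k),
      (∀ i ∈ S, 0 < RitzBound.blockGap θ E hA₂ i ∧
        (∀ j, j ≠ i → 0 < RitzBound.pairGap θ E i j) ∧
        0 < RitzBound.gapCoeff E i (RitzBound.blockGap θ E hA₂ i) (RitzBound.pairGap θ E i)) →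
      ∃ lam : Fin k → ℝ, Set.InjOn lam S ∧
        ∀ i ∈ S, RitzBound.IsEigenvalue (RitzBound.ritzMatrix θ E A₂) (lam i) ∧
          (∃ p : ℝ → ℝ, RitzBound.IsEigenPath θ E A₂ i p ∧ p 1 = lam i) ∧
          |lam i - θ i| ≤
            RitzBound.gapCoeff E i (RitzBound.blockGap θ E hA₂ i) (RitzBound.pairGap θ E i)
              * RitzBound.colNorm E i ^ 2) ∧
    -- the bound with any positive lower bounds of the gaps along an eigenvalue path
    (∀ (i : Fin k) (p : ℝ → ℝ), RitzBound.IsEigenPath θ E A₂ i p →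
      ∀ (a : ℝ) (b : Fin k → ℝ), 0 < a →
        (∀ t ∈ Set.Icc (0 : ℝ) 1, ∀ j, a ≤ |p t - hA₂.eigenvalues j|) →
        (∀ j, j ≠ i → 0 < b j ∧ ∀ t ∈ Set.Icc (0 : ℝ) 1, b j ≤ |p t - θ j|) →
        0 < RitzBound.gapCoeff E i a b →
        RitzBound.IsEigenvalue (RitzBound.ritzMatrix θ E A₂) (p 1) ∧
          |p 1 - θ i| ≤ RitzBound.gapCoeff E i a b * RitzBound.colNorm E i ^ 2) := by
  open RitzBound in
  refine ⟨fun i => ?_, fun S hS => ?_, fun i p hp a b ha hpa hpb hd => ?_⟩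
  · obtain ⟨r, hr⟩ := exists_scaledEigenvalue_eq θ E hA₂ (c := Function.update 1 i 0) (i := i)
      (by simp)
    exact ⟨_, isEigenPath_scaledEigenvalue θ E hA₂ hr⟩
  -- Indices are fixed at `c = 0`, where all columns are off, so that `r i = r j` will force `θ i =
  -- θ j`.
  · choose r hr using fun i =>
      exists_scaledEigenvalue_eq θ E hA₂ (c := 0) (i := i) (Pi.zero_apply i)
    have hr0 (i) (hi : i ∈ S) := scaledEigenvalue_update_zero_eq (hS i hi).1 (hS i hi).2.1
      (hS i hi).2.2 (hr i)
    have hclose (i) (hi : i ∈ S) := abs_scaledEigenvalue_one_sub_le (hr0 i hi)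
    have hev (i) : IsEigenvalue (ritzMatrix θ E A₂) (scaledEigenvalue θ E hA₂ 1 (r i)) := by
      simpa only [scaleCols_one] using isEigenvalue_scaledEigenvalue θ E hA₂ 1 (r i)
    refine ⟨fun i => scaledEigenvalue θ E hA₂ 1 (r i), fun i hi j _ hij => ?_, fun i hi => ?_⟩
    · obtain ⟨ha, hb, hd⟩ := hS i hi
      have hrij : r i = r j := scaledEigenvalue_inj ha hb hd (by simp) (hclose i hi) hij
      by_contra hne
      have hθ : θ i = θ j := by rw [← hr i, ← hr j, hrij]
      have hpos := hb j (Ne.symm hne)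
      -- Equal Ritz values would make the pair gap `-‖E_i‖ ≤ 0`.
      rw [pairGap, hθ, sub_self, abs_zero] at hpos
      linarith [colNorm_nonneg E i]
    · obtain ⟨ha, hb, hd⟩ := hS i hi
      exact ⟨hev i, ⟨_, isEigenPath_scaledEigenvalue θ E hA₂ (hr0 i hi), by simp⟩,
        abs_sub_le_gapCoeff_mul hA₂ ha.le (blockGap_le_abs_sub (hclose i hi))
          (fun j hj => ⟨hb j hj, pairGap_le_abs_sub (hclose i hi) j⟩) hd (hev i)⟩
  · have h1 : (1 : ℝ) ∈ Set.Icc (0 : ℝ) 1 := by simp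
    have hev : IsEigenvalue (ritzMatrix θ E A₂) (p 1) := by
      have h := hp.2.2 1 h1
      rwa [pathMatrix_eq_ritzMatrix, Function.update_eq_self_iff.2 (Pi.one_apply i).symm,
        scaleCols_one] at h
    exact ⟨hev, abs_sub_le_gapCoeff_mul hA₂ ha.le (hpa 1 h1)
      (fun j hj => ⟨(hpb j hj).1, (hpb j hj).2 1 h1⟩) hd hev⟩
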